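/- Let $n\ge 0$, $q_1,q_2\in\mathbb C$, and let $e^{V}=e^{V(z,\bar z)}$ be a weight on $\mathbb C$ all of whose bi-moments $g_{km}=\int_{\mathbb C}z^k\bar z^m e^{V(z,\bar z)}\,d^2z$ $(k,m\ge 0)$ exist (absolutely convergent integrals). Put $e^{\tilde V_{km}}:=g_{km}$, and suppose that $\sum_{h,h'\ge 0}q_1^{kh}q_2^{mh'}e^{\tilde V_{hh'}}$ converges absolutely for all $k,m\ge 0$. For $\mathbf t=(t_1,t_2,\dots)$ let $s_\lambda(\mathbf t)=\det(h_{\lambda_i-i+j}(\mathbf t))$, $\sum_k z^kh_k(\mathbf t)=\exp\sum_{m\ge1}z^mt_m$, be the Schur functions, $\xi(\mathbf t,x)=\sum_{m\ge1}t_mx^m$, and $\Delta(x)=\prod_{i<j}(x_i-x_j)$. The partition function of the model of normal matrices with potential $V$ is understood as its perturbation series in the coupling constants, $$Z_n(V;\mathbf t,\mathbf t')=n!\sum_{\ell(\lambda),\ell(\lambda')\le n}\det\bigl(g_{h_ih'_j}\bigr)_{i,j=1}^n\,s_\lambda(\mathbf t)\,s_{\lambda'}(\mathbf t'),\qquad h_i=\lambda_i-i+n,\quad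 h'_i=\lambda'_i-i+n .$$ For partitions $\lambda^*,\lambda'^*$ of length at most $n$ put $x_i=q_1^{h_i^*}$, $y_i=q_2^{h_i'^*}$ with $h_i^*=\lambda_i^*-i+n$, $h_i'^*=\lambda_i'^*-i+n$; let $t_m(x)=\frac1m\sum_i x_i^m$, $t'_m(y)=\frac1m\sum_i y_i^m$, and $$Z_n(V;\lambda^*,\lambda'^*;q_1,q_2)=Z_n(V;\mathbf t(x),\mathbf t'(y))\,\Delta(x)\Delta(y)$$ (this is read as $0$ if $\Delta(x)\Delta(y)=0$). Let $$Z_n^{\rm discr}(\tilde V;\tilde{\mathbf t},\tilde{\mathbf t}';q_1,q_2)=\frac1{n!}\sum_{h,h'\in\mathbb Z_{\ge0}^n}\Delta(q_1^h)\Delta(q_2^{h'})\prod_{i=1}^n e^{\xi(\tilde{\mathbf t},q_1^{h_i})+\xi(\tilde{\mathbf t}',q_2^{h'_i})}e^{\tilde V_{h_ih'_i}},$$ a formal power series in $\tilde{\mathbf t},\tilde{\mathbf t}'$ (summed coefficientwise). Let $s_\lambda(\tilde\partial)$, $s_\lambda(\tilde\partial')$ be the differential operators obtained from $s_\lambda(\mathbf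 t)$ by replacing $t_m$ by $\frac1m\partial/\partial\tilde t_m$, respectively $\frac1m\partial/\partial\tilde t'_m$. Let $a_n:=n!$. Then the coefficients of $Z_n^{\rm discr}$ converge absolutely, the series for $Z_n(V;\mathbf t(x),\mathbf t'(y))$ converges absolutely whenever $\Delta(x)\Delta(y)\ne0$, and $$Z_n(V;0,0;q_1,q_2)=a_n\,Z_n^{\rm discr}(\tilde V;\tilde{\mathbf t},\tilde{\mathbf t}';q_1,q_2)\big|_{\tilde{\mathbf t}=\tilde{\mathbf t}'=0},$$ $$Z_n(V;\lambda^*,\lambda'^*;q_1,q_2)=a_n\,s_{\lambda^*}(\tilde\partial)\,s_{\lambda'^*}(\tilde\partial')\,Z_n^{\rm discr}(\tilde V;\tilde{\mathbf t},\tilde{\mathbf t}';q_1,q_2)\big|_{\tilde{\mathbf t}=\tilde{\mathbf t}'=0}$$ for all $\lambda^*,\lambda'^*$ of length at most $n$. If, moreover, $e^{V_{\tilde{\mathbf t},\tilde{\mathbf t}'}}$ is a deformation of $e^V$, i.e. a formal power series in $\tilde{\mathbf t},\tilde{\mathbf t}'$ whose coefficients are weights on $\mathbb C$ with absolutely convergent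 bi-moments, such that $$\int_{\mathbb C}z^k\bar z^m e^{V_{\tilde{\mathbf t},\tilde{\mathbf t}'}(z,\bar z)}\,d^2z=e^{\xi(\tilde{\mathbf t},q_1^k)+\xi(\tilde{\mathbf t}',q_2^m)}e^{\tilde V_{km}}\qquad(k,m\ge0),$$ then the restriction to $\tilde{\mathbf t}=\tilde{\mathbf t}'=0$ can be dropped: as formal power series in $\tilde{\mathbf t},\tilde{\mathbf t}'$ (with the same kind of convergence, coefficientwise), $$Z_n(V_{\tilde{\mathbf t},\tilde{\mathbf t}'};0,0;q_1,q_2)=a_n\,Z_n^{\rm discr}(\tilde V;\tilde{\mathbf t},\tilde{\mathbf t}';q_1,q_2),$$ $$Z_n(V_{\tilde{\mathbf t},\tilde{\mathbf t}'};\lambda^*,\lambda'^*;q_1,q_2)=a_n\,s_{\lambda^*}(\tilde\partial)\,s_{\lambda'^*}(\tilde\partial')\,Z_n^{\rm discr}(\tilde V;\tilde{\mathbf t},\tilde{\mathbf t}';q_1,q_2).$$ -/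

import Mathlib

open MeasureTheory

noncomputable section

namespace NormalMatrixModel

/-- Partitions `a = (a_1 ≥ a_2 ≥ ... ≥ a_n ≥ 0)` of length at most `n`. -/
abbrev Ptn (n : ℕ) : Type := {a : Fin n → ℕ // Antitone a}

/-- The zero partition. -/
def Ptn.zero (n : ℕ) : Ptn n := ⟨fun _ => 0, fun _ _ _ => le_rfl⟩

/-- The strictly decreasing sequence `h_i = a_i - i + n` (`1 ≤ i ≤ n`) attached to a partition;
here `i : Fin n` is counted from `0`. -/
def hseq {n : ℕ} (a : Ptn n) (i : Fin n) : ℕ := a.1 i + (n - 1 - (i : ℕ))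

/-- The elementary Schur function `h_k(t_1, t_2, ...)`, a polynomial in the `t_m`, defined by
`∑_k z^k h_k(t) = exp (∑_{m ≥ 1} z^m t_m)`. -/
def elemSchur (k : ℕ) : MvPolynomial ℕ+ ℂ :=
  PowerSeries.coeff k
    ((PowerSeries.exp (MvPolynomial ℕ+ ℂ)).subst
      (PowerSeries.mk fun m => if h : 0 < m then MvPolynomial.X (Nat.toPNat m h) else 0))

/-- The Schur function `s_a(t) = det (h_{a_i - i + j}(t))`, as a polynomial in the `t_m`, with
`h_k = 0` for `k < 0`. The determinant is taken of size `n ≥ ℓ(a)`, which gives the same value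
as size `ℓ(a)`. -/
def schurPoly {n : ℕ} (a : Ptn n) : MvPolynomial ℕ+ ℂ :=
  Matrix.det (Matrix.of fun i j : Fin n =>
    if (i : ℕ) ≤ a.1 i + j then elemSchur (a.1 i + j - i) else 0)

/-- The value `s_a(t)` at a sequence of complex times. -/
def schur {n : ℕ} (a : Ptn n) (t : ℕ+ → ℂ) : ℂ := MvPolynomial.eval t (schurPoly a)

/-- `Δ(x) = ∏_{i < j} (x_i - x_j)`. -/
def vdm {n : ℕ} (x : Fin n → ℂ) : ℂ := ∏ i, ∏ j ∈ Finset.Ioi i, (x i - x j)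

/-- The times `t_m(x) = (1/m) ∑_i x_i^m`. -/
def powerTimes {n : ℕ} (x : Fin n → ℂ) (m : ℕ+) : ℂ := (1 / ((m : ℕ) : ℂ)) * ∑ i, x i ^ (m : ℕ)

/-- The points `x_i = q^{h_i}` attached to a partition. -/
def qpoints {n : ℕ} (q : ℂ) (a : Ptn n) (i : Fin n) : ℂ := q ^ hseq a i

/-- The bi-moment `∫ z^k z̄^m w(z) d²z` of a weight `w(z) = e^{V(z, z̄)}`. -/
def bimoment (w : ℂ → ℂ) (k m : ℕ) : ℂ := ∫ z : ℂ, z ^ k * (starRingEnd ℂ z) ^ m * w z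

/-- The term `n! det(g_{h_i h'_j}) s_a(t) s_b(t')` of the perturbation series of the partition
function of the model of normal matrices with bi-moments `g`. -/
def zNormalTerm (n : ℕ) (g : ℕ → ℕ → ℂ) (t t' : ℕ+ → ℂ) (p : Ptn n × Ptn n) : ℂ :=
  (n.factorial : ℂ) * Matrix.det (Matrix.of fun i j : Fin n => g (hseq p.1 i) (hseq p.2 j))
    * schur p.1 t * schur p.2 t'

/-- The partition function `Z_n(V; t, t')` of the model of normal matrices, where `w = e^V`, as its
perturbation series in the coupling constants:
`n! ∑_{a, b} det(g_{h_i h'_j}) s_a(t) s_b(t')`. -/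
def zNormal (n : ℕ) (w : ℂ → ℂ) (t t' : ℕ+ → ℂ) : ℂ :=
  ∑' p : Ptn n × Ptn n, zNormalTerm n (bimoment w) t t' p

/-- `Z_n(V; a, b; q₁, q₂) = Z_n(V; t(x), t'(y)) Δ(x) Δ(y)` with `x_i = q₁^{h_i}`,
`y_i = q₂^{h'_i}` given by the partitions `a`, `b`. -/
def zDual (n : ℕ) (w : ℂ → ℂ) (q₁ q₂ : ℂ) (a b : Ptn n) : ℂ :=
  zNormal n w (powerTimes (qpoints q₁ a)) (powerTimes (qpoints q₂ b))
    * vdm (qpoints q₁ a) * vdm (qpoints q₂ b)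

/-- Index set of the two infinite sequences of variables: `Sum.inl m` stands for `t̃_m` and
`Sum.inr m` for `t̃'_m`. -/
abbrev TimeIdx : Type := ℕ+ ⊕ ℕ+

/-- Formal power series in `t̃_1, t̃_2, ...` and `t̃'_1, t̃'_2, ...`. -/
abbrev TimeSeries : Type := MvPowerSeries TimeIdx ℂ

/-- The formal power series `exp (ξ(t̃, x) + ξ(t̃', y))`, where `ξ(t, x) = ∑_m t_m x^m`.
Its coefficient at `∏ t̃_m^{α_m} ∏ t̃'_m^{α'_m}` is
`∏ x^{m α_m} / α_m! ∏ y^{m α'_m} / α'_m!`. -/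
def expXi (x y : ℂ) : TimeSeries := fun α =>
  α.prod fun i e =>
    (Sum.elim (fun m : ℕ+ => x ^ (m : ℕ)) (fun m : ℕ+ => y ^ (m : ℕ)) i) ^ e / (e.factorial : ℂ)

/-- The summand `Δ(q₁^h) Δ(q₂^{h'}) ∏_i e^{ξ(t̃, q₁^{h_i}) + ξ(t̃', q₂^{h'_i})} W_{h_i h'_i}`. -/
def zDiscrTerm (n : ℕ) (W : ℕ → ℕ → ℂ) (q₁ q₂ : ℂ) (p : (Fin n → ℕ) × (Fin n → ℕ)) :
    TimeSeries :=
  (vdm (fun i => q₁ ^ p.1 i) * vdm (fun i => q₂ ^ p.2 i)) •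
    ∏ i, (W (p.1 i) (p.2 i) • expXi (q₁ ^ p.1 i) (q₂ ^ p.2 i))

/-- The discrete partition function
`(1/n!) ∑_{h, h' ≥ 0} Δ(q₁^h) Δ(q₂^{h'}) ∏_i e^{ξ(t̃, q₁^{h_i}) + ξ(t̃', q₂^{h'_i})} W_{h_i h'_i}`
with `W = e^{Ṽ}`, as its perturbation series in `t̃`, `t̃'`; the sum is taken coefficientwise. -/
def zDiscr (n : ℕ) (W : ℕ → ℕ → ℂ) (q₁ q₂ : ℂ) : TimeSeries := fun α =>
  (1 / (n.factorial : ℂ)) *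
    ∑' p : (Fin n → ℕ) × (Fin n → ℕ), MvPowerSeries.coeff α (zDiscrTerm n W q₁ q₂ p)

/-- The index `m` of `t̃_m` or of `t̃'_m`. -/
def timeIndex : TimeIdx → ℕ := Sum.elim (fun m => (m : ℕ)) (fun m => (m : ℕ))

/-- `∂̃_m = (1/m) ∂/∂t̃_m`, respectively `∂̃'_m = (1/m) ∂/∂t̃'_m`. -/
def dTilde (i : TimeIdx) (F : TimeSeries) : TimeSeries :=
  (1 / (timeIndex i : ℂ)) • MvPowerSeries.pderiv ℂ i F

instance dTilde_leftCommutative : LeftCommutative dTilde where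
  left_comm i j F := by
    unfold dTilde
    rw [Derivation.map_smul, Derivation.map_smul, smul_comm]
    congr 2
    ext α
    rw [MvPowerSeries.coeff_pderiv, MvPowerSeries.coeff_pderiv, MvPowerSeries.coeff_pderiv,
      MvPowerSeries.coeff_pderiv, add_right_comm]
    by_cases h : i = j
    · subst h; rfl
    · simp [h, Ne.symm h]
      ring

/-- The differential operator `P(∂̃, ∂̃')` with constant coefficients obtained from a polynomial
`P` by replacing every variable by the corresponding (commuting) operator `∂̃_m` or `∂̃'_m`. -/
def diffOp (P : MvPolynomial TimeIdx ℂ) (F : TimeSeries) : TimeSeries :=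
  ∑ α ∈ P.support, MvPolynomial.coeff α P • (Finsupp.toMultiset α).foldr dTilde F

/-- `s_a(∂̃)`. -/
def schurD {n : ℕ} (a : Ptn n) : TimeSeries → TimeSeries :=
  diffOp (MvPolynomial.rename Sum.inl (schurPoly a))

/-- `s_b(∂̃')`. -/
def schurD' {n : ℕ} (b : Ptn n) : TimeSeries → TimeSeries :=
  diffOp (MvPolynomial.rename Sum.inr (schurPoly b))

/-- The bi-moments of a weight that is a formal power series in `t̃`, `t̃'` with coefficients
`wd α : ℂ → ℂ`, taken coefficientwise. -/
def formalBimoment (wd : (TimeIdx →₀ ℕ) → ℂ → ℂ) (k m : ℕ) : TimeSeries := fun α =>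
  bimoment (wd α) k m

/-- The term of the perturbation series of the normal matrix model with a weight that is a formal
power series in `t̃`, `t̃'`. -/
def zNormalTermFormal (n : ℕ) (G : ℕ → ℕ → TimeSeries) (t t' : ℕ+ → ℂ) (p : Ptn n × Ptn n) :
    TimeSeries :=
  ((n.factorial : ℂ) * schur p.1 t * schur p.2 t') •
    Matrix.det (Matrix.of fun i j : Fin n => G (hseq p.1 i) (hseq p.2 j))

/-- `Z_n(V_{t̃, t̃'}; t, t')` for a weight `e^{V_{t̃, t̃'}}` that is a formal power series in
`t̃`, `t̃'`; the perturbation series in `t`, `t'` is summed coefficientwise. -/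
def zNormalFormal (n : ℕ) (wd : (TimeIdx →₀ ℕ) → ℂ → ℂ) (t t' : ℕ+ → ℂ) : TimeSeries := fun α =>
  ∑' p : Ptn n × Ptn n, MvPowerSeries.coeff α (zNormalTermFormal n (formalBimoment wd) t t' p)

/-- `Z_n(V_{t̃, t̃'}; a, b; q₁, q₂) = Z_n(V_{t̃, t̃'}; t(x), t'(y)) Δ(x) Δ(y)`. -/
def zDualFormal (n : ℕ) (wd : (TimeIdx →₀ ℕ) → ℂ → ℂ) (q₁ q₂ : ℂ) (a b : Ptn n) : TimeSeries :=
  (vdm (qpoints q₁ a) * vdm (qpoints q₂ b)) •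
    zNormalFormal n wd (powerTimes (qpoints q₁ a)) (powerTimes (qpoints q₂ b))

end NormalMatrixModel

end

open NormalMatrixModel

/-! ### Generating series of Schur functions and the bialternant formula -/

noncomputable section
namespace NormalMatrixModel
open PowerSeries Finset

/-! The duality rests on the symmetry of the matrix `q ^ (h_i h'_j)` in `h` and `h'`
(`alternant_pow_comm`), read through the bialternant formula `s_a(t(x)) Δ(x) = det (x_i ^ h_j)`
(`schur_mul_vdm`).

On the discrete side, every summand is an eigenfunction of the `∂̃_m`, with eigenvalues the power
sum times of `q₁ ^ h` and `q₂ ^ h'`. So `s_a(∂̃) s_b(∂̃')` multiplies it by two Schur values, which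
the Vandermonde factors turn into alternants. By the symmetry these are alternants in the fixed
points `x`, `y`, with the summation variables as exponents (`hasSum_coeff_schurD_zDiscr`).

Alternants are antisymmetric in the exponents. The sum over all sequences therefore collapses to one
over pairs of partitions, and the product of the `W` factors becomes `n!` times a determinant
(`hasSum_partitions_of_hasSum`). The bialternant formula, now used at `x` and `y`, recognises the
terms of the normal matrix series times `Δ(x) Δ(y)`. Convergence comes from the discrete side
throughout. -/

/-- The power series `∑_{m ≥ 1} t_m z^m` over a commutative ring. -/
def xiSeries {R : Type*} [CommRing R] (t : ℕ+ → R) : PowerSeries R :=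
  PowerSeries.mk fun m => if h : 0 < m then t (Nat.toPNat m h) else 0

lemma hasSubst_xiSeries {R : Type*} [CommRing R] (t : ℕ+ → R) :
    PowerSeries.HasSubst (xiSeries t) :=
  PowerSeries.HasSubst.of_constantCoeff_zero' (by simp [xiSeries])

/-- The generating series `exp (∑_{m ≥ 1} t_m z^m)` of the elementary Schur functions. -/
def genSeries (t : ℕ+ → ℂ) : PowerSeries ℂ := (PowerSeries.exp ℂ).subst (xiSeries t)

lemma eval_elemSchur (t : ℕ+ → ℂ) (k : ℕ) :
    MvPolynomial.eval t (elemSchur k) = PowerSeries.coeff k (genSeries t) := by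
  have h : (PowerSeries.map (MvPolynomial.eval t))
      ((PowerSeries.exp (MvPolynomial ℕ+ ℂ)).subst (xiSeries MvPolynomial.X)) = genSeries t := by
    rw [genSeries]
    refine (PowerSeries.map_subst (hasSubst_xiSeries _) _).trans ?_
    rw [PowerSeries.map_exp]
    congr 1
    ext m
    change PowerSeries.coeff m (PowerSeries.map _ _) = _
    rw [PowerSeries.coeff_map]
    simp only [xiSeries, PowerSeries.coeff_mk]
    split_ifs <;> simp
  rw [← h, PowerSeries.coeff_map]
  rfl

lemma constantCoeff_genSeries (t : ℕ+ → ℂ) : PowerSeries.constantCoeff (genSeries t) = 1 := by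
  have h : PowerSeries.constantCoeff (xiSeries t) = 0 := by simp [xiSeries]
  have h2 := PowerSeries.constantCoeff_subst (hasSubst_xiSeries t) (PowerSeries.exp ℂ)
  refine h2.trans ?_
  rw [finsum_eq_single _ 0]
  · simp
  · intro d hd
    have : MvPowerSeries.constantCoeff (xiSeries t) = 0 := h
    simp [this, hd]

lemma derivative_genSeries (t : ℕ+ → ℂ) :
    d⁄dX ℂ (genSeries t) = genSeries t * d⁄dX ℂ (xiSeries t) := by
  rw [genSeries, PowerSeries.derivative_subst (hasSubst_xiSeries t), PowerSeries.derivative_exp]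

lemma one_sub_mul_geom (c : ℂ) :
    (1 - C c * X) * PowerSeries.mk (fun m => c ^ m) = 1 := by
  ext m
  cases m with
  | zero => simp
  | succ m =>
    rw [sub_mul, one_mul, mul_assoc, map_sub, coeff_C_mul, coeff_succ_X_mul]
    simp [coeff_one, pow_succ']

lemma derivative_prod_one_sub {ι : Type*} (s : Finset ι) (x : ι → ℂ) :
    d⁄dX ℂ (∏ i ∈ s, (1 - C (x i) * X)) =
      - ((∏ i ∈ s, (1 - C (x i) * X)) *
        ∑ i ∈ s, C (x i) * PowerSeries.mk (fun m => x i ^ m)) := by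
  classical
  induction s using Finset.induction_on with
  | empty => simp
  | insert i s hi ih =>
    rw [prod_insert hi, sum_insert hi, Derivation.leibniz, ih]
    have h : d⁄dX ℂ (1 - C (x i) * X) = - C (x i) := by
      rw [map_sub, Derivation.leibniz]
      simp
    rw [h]
    simp only [smul_eq_mul]
    linear_combination (- C (x i) * ∏ i ∈ s, (1 - C (x i) * X)) * (- one_sub_mul_geom (x i))

lemma derivative_xiSeries_powerTimes {n : ℕ} (x : Fin n → ℂ) :
    d⁄dX ℂ (xiSeries (powerTimes x)) =
      ∑ i, C (x i) * PowerSeries.mk (fun m => x i ^ m) := by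
  ext m
  rw [coeff_derivative, map_sum]
  have : ((m : ℂ) + 1) ≠ 0 := by exact_mod_cast Nat.succ_ne_zero m
  simp only [xiSeries, coeff_mk, coeff_C_mul, powerTimes, Nat.succ_pos, dite_true, ← pow_succ',
    Nat.toPNat, PNat.mk_coe]
  push_cast
  field_simp

/-- At power sum times, `exp (∑ t_m z^m) = ∏ (1 - x_i z)⁻¹`. The logarithmic derivatives of the two
factors cancel, so the product has zero derivative and constant term 1. -/
lemma genSeries_mul_prod {n : ℕ} (x : Fin n → ℂ) :
    genSeries (powerTimes x) * ∏ i, (1 - C (x i) * X) = 1 := by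
  apply PowerSeries.derivative.ext
  · rw [Derivation.leibniz, derivative_genSeries, derivative_prod_one_sub,
      derivative_xiSeries_powerTimes, PowerSeries.derivative_one]
    simp only [smul_eq_mul]
    ring
  · simp [constantCoeff_genSeries, map_prod]

lemma genSeries_mul_prod_erase {n : ℕ} (x : Fin n → ℂ) (l : Fin n) :
    genSeries (powerTimes x) * ∏ i ∈ univ.erase l, (1 - C (x i) * X) =
      PowerSeries.mk (fun m => x l ^ m) := by
  have h := genSeries_mul_prod x
  rw [← mul_prod_erase _ _ (mem_univ l)] at h
  linear_combination PowerSeries.mk (fun m => x l ^ m) * h -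
    (genSeries (powerTimes x) * ∏ i ∈ univ.erase l, (1 - C (x i) * X)) * one_sub_mul_geom (x l)

/-- The polynomial `∏_{i ≠ l} (1 - x_i z)`. -/
def erasePoly {n : ℕ} (x : Fin n → ℂ) (l : Fin n) : Polynomial ℂ :=
  ∏ i ∈ univ.erase l, (1 - Polynomial.C (x i) * Polynomial.X)

lemma natDegree_erasePoly {n : ℕ} (x : Fin n → ℂ) (l : Fin n) :
    (erasePoly x l).natDegree < n := by
  have h : (erasePoly x l).natDegree ≤ ∑ i ∈ univ.erase l, 1 := by
    refine (Polynomial.natDegree_prod_le _ _).trans (sum_le_sum fun i _ => ?_)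
    compute_degree
  have := l.2
  simp at h
  omega

/-- Compare coefficients of `z^m` in `genSeries_mul_prod_erase`. The reversed index `n - 1 - j` is
chosen so that at `m = hseq a i` the shift `m - (n - 1 - j)` is the Jacobi–Trudi index `a_i - i +
j`. -/
lemma pow_eq_sum_erasePoly {n : ℕ} (x : Fin n → ℂ) (l : Fin n) (m : ℕ) :
    x l ^ m = ∑ j : Fin n,
      (if n - 1 - (j : ℕ) ≤ m then coeff (m - (n - 1 - j)) (genSeries (powerTimes x)) else 0) *
        (erasePoly x l).coeff (n - 1 - j) := by
  have h := congrArg (PowerSeries.coeff m) (genSeries_mul_prod_erase x l)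
  have h2 : ∏ i ∈ univ.erase l, (1 - C (x i) * X) = (erasePoly x l : PowerSeries ℂ) := by
    rw [erasePoly, ← Polynomial.coeToPowerSeries.ringHom_apply, map_prod]
    simp
  rw [h2, coeff_mk, mul_comm, coeff_mul, Nat.sum_antidiagonal_eq_sum_range_succ_mk] at h
  simp only [Polynomial.coeff_coe] at h
  rw [← h, Fin.sum_univ_eq_sum_range (fun j => (if n - 1 - j ≤ m then
    coeff (m - (n - 1 - j)) (genSeries (powerTimes x)) else 0) *
        (erasePoly x l).coeff (n - 1 - j)) n, Finset.sum_range_reflect (fun j => (if j ≤ m then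
    coeff (m - j) (genSeries (powerTimes x)) else 0) * (erasePoly x l).coeff j) n]
  simp only [ite_mul, zero_mul]
  rw [← sum_filter]
  symm
  -- The extra indices satisfy `n ≤ k ≤ m`, beyond the degree of `erasePoly x l`.
  refine sum_subset_zero_on_sdiff ?_ ?_ ?_
  · intro k hk
    simp at hk ⊢
    omega
  · intro k hk
    simp at hk
    rw [Polynomial.coeff_eq_zero_of_natDegree_lt, zero_mul]
    have := natDegree_erasePoly x l
    have : n ≤ k := by by_contra hc; have := hk.2 (by omega); omega
    omega
  · intro k hk
    ring

/-- The matrix whose determinant is `s_a(t)`. -/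
def jacobiTrudi {n : ℕ} (a : Ptn n) (t : ℕ+ → ℂ) : Matrix (Fin n) (Fin n) ℂ :=
  Matrix.of fun i j =>
    if (i : ℕ) ≤ a.1 i + j then coeff (a.1 i + j - i) (genSeries t) else 0

lemma schur_eq_det {n : ℕ} (a : Ptn n) (t : ℕ+ → ℂ) : schur a t = (jacobiTrudi a t).det := by
  rw [schur, schurPoly, RingHom.map_det]
  congr 1
  ext i j
  simp only [RingHom.mapMatrix_apply, Matrix.map_apply, Matrix.of_apply, jacobiTrudi]
  split_ifs
  · exact eval_elemSchur _ _
  · simp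

lemma schur_zero {n : ℕ} (t : ℕ+ → ℂ) : schur (Ptn.zero n) t = 1 := by
  rw [schur_eq_det, Matrix.det_of_isUpperTriangular]
  · refine prod_eq_one fun i _ => ?_
    simp [jacobiTrudi, Ptn.zero, constantCoeff_genSeries]
  · intro i j hij
    simp only [id] at hij
    simp [jacobiTrudi, Ptn.zero, hij]

/-- The alternant `det (x_i ^ h_j)`. -/
def alternant {n : ℕ} (x : Fin n → ℂ) (h : Fin n → ℕ) : ℂ :=
  Matrix.det (Matrix.of fun i j => x i ^ h j)

/-- The transposed alternant factors as the Jacobi–Trudi matrix times a matrix independent of `a`.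
Taking `a = 0` then identifies the second determinant as `Δ(x)`, with no need for distinct `x_i`. -/
lemma alternant_eq_schur_mul_det {n : ℕ} (a : Ptn n) (x : Fin n → ℂ) :
    alternant x (hseq a) = schur a (powerTimes x) *
      Matrix.det (Matrix.of fun j l : Fin n => (erasePoly x l).coeff (n - 1 - j)) := by
  rw [alternant, ← Matrix.det_transpose, schur_eq_det, ← Matrix.det_mul]
  congr 1
  ext i l
  rw [Matrix.mul_apply, Matrix.transpose_apply, Matrix.of_apply, pow_eq_sum_erasePoly]
  refine sum_congr rfl fun j _ => ?_
  have hi := i.2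
  have hj := j.2
  have h1 : n - 1 - (j : ℕ) ≤ hseq a i ↔ (i : ℕ) ≤ a.1 i + j := by
    rw [hseq]
    omega
  simp only [jacobiTrudi, Matrix.of_apply, h1]
  congr 1
  split_ifs with h
  · congr 2
    rw [hseq]
    omega
  · rfl

lemma alternant_zero {n : ℕ} (x : Fin n → ℂ) : alternant x (hseq (Ptn.zero n)) = vdm x := by
  have h := Matrix.det_projVandermonde (fun _ => 1) x
  simp only [one_mul] at h
  rw [vdm, ← h, alternant]
  congr 1
  ext i j
  simp only [Matrix.of_apply, Matrix.projVandermonde, Matrix.rectVandermonde_apply, hseq, Ptn.zero,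
    Fin.val_rev, one_pow, one_mul, zero_add]
  congr 1
  omega

/-- The bialternant formula for Schur functions. -/
lemma schur_mul_vdm {n : ℕ} (a : Ptn n) (x : Fin n → ℂ) :
    schur a (powerTimes x) * vdm x = alternant x (hseq a) := by
  rw [alternant_eq_schur_mul_det, ← alternant_zero, alternant_eq_schur_mul_det (Ptn.zero n),
    schur_zero, one_mul]

end NormalMatrixModel
end

/-! ### Sequences, permutations and antisymmetrization -/

noncomputable section
namespace NormalMatrixModel
open Finset

lemma hseq_strictAnti {n : ℕ} (a : Ptn n) : StrictAnti (hseq a) := by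
  intro i j hij
  have h := a.2 hij.le
  have h2 : (i : ℕ) < j := hij
  have := j.2
  simp only [hseq]
  omega

lemma hseq_injective {n : ℕ} : Function.Injective (hseq (n := n)) := by
  intro a b h
  ext i
  have := congrFun h i
  simp only [hseq] at this
  omega

/-- Each step drops by at least 1. With `i + d = n - 1` this gives `n - 1 - i ≤ g i`, so the
truncated subtraction inverting `hseq` is exact. -/
lemma StrictAnti.add_sub_le {n : ℕ} {g : Fin n → ℕ} (hg : StrictAnti g) {i : Fin n} :
    ∀ (d : ℕ) (hd : i + d < n), g ⟨i + d, hd⟩ + d ≤ g i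
  | 0, _ => le_rfl
  | d + 1, hd => by
    have h1 := StrictAnti.add_sub_le hg d (by omega : i + d < n)
    have h2 : g ⟨i + (d + 1), hd⟩ < g ⟨i + d, by omega⟩ := hg (by simp [Fin.lt_def])
    omega

lemma exists_hseq_eq {n : ℕ} {g : Fin n → ℕ} (hg : StrictAnti g) : ∃ a : Ptn n, hseq a = g := by
  have key : ∀ i : Fin n, n - 1 - (i : ℕ) ≤ g i := fun i => by
    have := i.2
    have := StrictAnti.add_sub_le hg (i := i) (n - 1 - i) (by omega)
    omega
  refine ⟨⟨fun i => g i - (n - 1 - i), fun i j hij => ?_⟩, ?_⟩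
  · have h2 : (i : ℕ) ≤ j := hij
    have := j.2
    have h := StrictAnti.add_sub_le hg (i := i) (j - i) (by omega)
    have h3 : (⟨i + (j - i), by omega⟩ : Fin n) = j := by ext; simp; omega
    rw [h3] at h
    simp only
    omega
  · ext i
    have := key i
    simp only [hseq]
    omega

/-- The sequence obtained by permuting the strictly decreasing sequence of a partition. -/
def permSeq {n : ℕ} (p : Ptn n × Equiv.Perm (Fin n)) : Fin n → ℕ := hseq p.1 ∘ p.2

/-- The range determines the decreasing rearrangement, hence the partition; injectivity of `hseq a`
then determines the permutation. -/
lemma permSeq_injective {n : ℕ} : Function.Injective (permSeq (n := n)) := by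
  rintro ⟨a, σ⟩ ⟨b, τ⟩ h
  simp only [permSeq] at h
  have hr : Set.range (hseq a) = Set.range (hseq b) := by
    rw [← σ.surjective.range_comp (hseq a), ← τ.surjective.range_comp (hseq b), h]
  have ha : StrictMono (OrderDual.toDual ∘ hseq a) := fun i j hij => hseq_strictAnti a hij
  have hb : StrictMono (OrderDual.toDual ∘ hseq b) := fun i j hij => hseq_strictAnti b hij
  have hab : OrderDual.toDual ∘ hseq a = OrderDual.toDual ∘ hseq b := by
    rw [← ha.range_inj hb, Set.range_comp, Set.range_comp, hr]
  have hab' : a = b := hseq_injective (funext fun i => congrFun hab i)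
  subst hab'
  refine Prod.ext rfl (Equiv.ext fun i => ?_)
  exact (hseq_strictAnti a).injective (congrFun h i)

lemma exists_permSeq_eq {n : ℕ} {h : Fin n → ℕ} (hh : Function.Injective h) :
    ∃ p, permSeq p = h := by
  set σ := Tuple.sort (OrderDual.toDual ∘ h) with hσ
  have hm : Antitone (h ∘ σ) := fun i j hij =>
    Tuple.monotone_sort (OrderDual.toDual ∘ h) hij
  obtain ⟨a, ha⟩ := exists_hseq_eq (hm.strictAnti_of_injective (hh.comp σ.injective))
  refine ⟨(a, σ⁻¹), ?_⟩
  ext i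
  simp [permSeq, ha]

lemma alternant_comp_perm {n : ℕ} (x : Fin n → ℂ) (h : Fin n → ℕ) (σ : Equiv.Perm (Fin n)) :
    alternant x (h ∘ σ) = (Equiv.Perm.sign σ : ℤ) * alternant x h :=
  Matrix.det_permute' σ (Matrix.of fun i j => x i ^ h j)

lemma alternant_eq_zero {n : ℕ} (x : Fin n → ℂ) {h : Fin n → ℕ} (hh : ¬ Function.Injective h) :
    alternant x h = 0 := by
  simp only [Function.Injective, not_forall] at hh
  obtain ⟨i, j, hij, hne⟩ := hh
  exact Matrix.det_zero_of_column_eq hne fun k => by simp [hij]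

/-- This exchange of base points and exponents is what swaps the two models. -/
lemma alternant_pow_comm {n : ℕ} (q : ℂ) (h h' : Fin n → ℕ) :
    alternant (fun i => q ^ h i) h' = alternant (fun i => q ^ h' i) h := by
  rw [alternant, ← Matrix.det_transpose, alternant]
  congr 1
  ext i j
  simp [← pow_mul, mul_comm]

/-- For fixed `τ`, substituting `σ τ` for `σ` makes the inner sum the determinant; there are `n!`
choices of `τ`. -/
lemma sum_perm_perm_prod {R : Type*} [CommRing R] {n : ℕ} (M : Matrix (Fin n) (Fin n) R) :
    ∑ s : Equiv.Perm (Fin n) × Equiv.Perm (Fin n),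
      ((Equiv.Perm.sign s.1 * Equiv.Perm.sign s.2 : ℤˣ) : ℤ) • ∏ i, M (s.1 i) (s.2 i) =
      n.factorial • M.det := by
  rw [Fintype.sum_prod_type_right]
  have : ∀ τ : Equiv.Perm (Fin n), ∑ σ : Equiv.Perm (Fin n),
      ((Equiv.Perm.sign σ * Equiv.Perm.sign τ : ℤˣ) : ℤ) • ∏ i, M (σ i) (τ i) = M.det := by
    intro τ
    rw [Matrix.det_apply, ← Equiv.sum_comp (Equiv.mulRight τ)]
    refine sum_congr rfl fun σ _ => ?_
    rw [← Equiv.prod_comp τ (fun i => M (σ i) i)]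
    simp [mul_assoc, Units.smul_def]
  simp only [this, sum_const, card_univ, Fintype.card_perm, Fintype.card_fin]

/-- Antisymmetrization: a sum of products of alternants over pairs of sequences reduces to a sum of
determinants over pairs of partitions. -/
lemma hasSum_partitions_of_hasSum {n : ℕ} {R : Type*} [CommRing R] [Algebra ℂ R] (φ : R →ₗ[ℂ] ℂ)
    (x y : Fin n → ℂ) (G : ℕ → ℕ → R) {s : ℂ}
    (hs : HasSum (fun p : (Fin n → ℕ) × (Fin n → ℕ) =>
      alternant x p.1 * alternant y p.2 * φ (∏ i, G (p.1 i) (p.2 i))) s) :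
    HasSum (fun p : Ptn n × Ptn n => (n.factorial : ℂ) *
      (alternant x (hseq p.1) * alternant y (hseq p.2) *
        φ (Matrix.det (Matrix.of fun i j => G (hseq p.1 i) (hseq p.2 j))))) s := by
  have hinj : Function.Injective (Prod.map (permSeq (n := n)) (permSeq (n := n))) :=
    permSeq_injective.prodMap permSeq_injective
  -- Only pairs of injective sequences contribute, and these are exactly the permuted sequences of
  -- pairs of partitions; the remaining sum is then grouped by the partitions.
  rw [← hinj.hasSum_iff] at hs
  · rw [← (Equiv.prodProdProdComm (Ptn n) (Ptn n) (Equiv.Perm (Fin n))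
      (Equiv.Perm (Fin n))).hasSum_iff] at hs
    refine hs.prod_fiberwise fun p => ?_
    obtain ⟨a, b⟩ := p
    convert hasSum_fintype _ using 1
    have h := congrArg φ (sum_perm_perm_prod
      (Matrix.of fun i j => G (hseq a i) (hseq b j)))
    rw [map_nsmul, map_sum, nsmul_eq_mul] at h
    calc _ = alternant x (hseq a) * alternant y (hseq b) * ((n.factorial : ℂ) *
        φ (Matrix.det (Matrix.of fun i j => G (hseq a i) (hseq b j)))) := by ring
      _ = _ := by
        rw [← h, mul_sum]
        refine sum_congr rfl fun s _ => ?_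
        simp only [Function.comp_apply, Equiv.prodProdProdComm_apply, Prod.map, permSeq,
          Matrix.of_apply]
        have h1 := alternant_comp_perm x (hseq a) s.1
        have h2 := alternant_comp_perm y (hseq b) s.2
        rw [map_zsmul, zsmul_eq_mul, h1, h2]
        push_cast
        ring
  · rintro ⟨h, h'⟩ hp
    by_cases h1 : Function.Injective h
    · by_cases h2 : Function.Injective h'
      · obtain ⟨p, rfl⟩ := exists_permSeq_eq h1
        obtain ⟨p', rfl⟩ := exists_permSeq_eq h2
        exact absurd ⟨(p, p'), rfl⟩ hp
      · simp [alternant_eq_zero y h2]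
    · simp [alternant_eq_zero x h1]

end NormalMatrixModel
end

/-! ### Constant coefficient operators and their eigenfunctions -/

noncomputable section
namespace NormalMatrixModel
open Finset

lemma coeff_dTilde (i : TimeIdx) (F : TimeSeries) (α : TimeIdx →₀ ℕ) :
    MvPowerSeries.coeff α (dTilde i F) = 1 / (timeIndex i : ℂ) *
      (MvPowerSeries.coeff (α + Finsupp.single i 1) F * (α i + 1)) := by
  rw [dTilde, MvPowerSeries.coeff_smul, MvPowerSeries.coeff_pderiv]

lemma dTilde_smul (i : TimeIdx) (c : ℂ) (F : TimeSeries) :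
    dTilde i (c • F) = c • dTilde i F := by
  rw [dTilde, Derivation.map_smul, smul_comm]
  rfl

lemma hasSum_coeff_dTilde {ι : Type*} {F : ι → TimeSeries} {S : TimeSeries}
    (h : ∀ α, HasSum (fun p => MvPowerSeries.coeff α (F p)) (MvPowerSeries.coeff α S))
    (i : TimeIdx) (α : TimeIdx →₀ ℕ) :
    HasSum (fun p => MvPowerSeries.coeff α (dTilde i (F p)))
      (MvPowerSeries.coeff α (dTilde i S)) := by
  simp only [coeff_dTilde]
  exact ((h _).mul_right _).mul_left _

/-- Each coefficient of the image is a finite linear combination of coefficients of the series, so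
the operator commutes with coefficientwise summation. -/
lemma hasSum_coeff_diffOp {ι : Type*} {F : ι → TimeSeries} {S : TimeSeries}
    (h : ∀ α, HasSum (fun p => MvPowerSeries.coeff α (F p)) (MvPowerSeries.coeff α S))
    (P : MvPolynomial TimeIdx ℂ) (α : TimeIdx →₀ ℕ) :
    HasSum (fun p => MvPowerSeries.coeff α (diffOp P (F p)))
      (MvPowerSeries.coeff α (diffOp P S)) := by
  have key : ∀ (s : Multiset TimeIdx) α,
      HasSum (fun p => MvPowerSeries.coeff α (s.foldr dTilde (F p)))
      (MvPowerSeries.coeff α (s.foldr dTilde S)) := by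
    intro s
    induction s using Multiset.induction_on with
    | empty => simpa using h
    | cons i s ih =>
      simp only [Multiset.foldr_cons]
      exact hasSum_coeff_dTilde ih i
  simp only [diffOp, map_sum, MvPowerSeries.coeff_smul]
  exact hasSum_sum fun β _ => (key _ α).mul_left _

/-- A constant coefficient differential operator acts on a common eigenfunction of the `∂̃_m` by
the value of the polynomial at the eigenvalues. -/
lemma diffOp_eigen {F : TimeSeries} {θ : TimeIdx → ℂ} (h : ∀ i, dTilde i F = θ i • F)
    (P : MvPolynomial TimeIdx ℂ) : diffOp P F = MvPolynomial.eval θ P • F := by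
  have key : ∀ s : Multiset TimeIdx, s.foldr dTilde F = (s.map θ).prod • F := by
    intro s
    induction s using Multiset.induction_on with
    | empty => simp
    | cons i s ih =>
      rw [Multiset.foldr_cons, ih, dTilde_smul, h, smul_smul, Multiset.map_cons,
        Multiset.prod_cons, mul_comm]
  rw [diffOp, MvPolynomial.eval_eq, sum_smul]
  refine sum_congr rfl fun α _ => ?_
  rw [key, smul_smul, Finsupp.toMultiset_map, Finsupp.prod_toMultiset]
  congr 2
  rw [Finsupp.prod_mapDomain_index (by simp) (by simp [pow_add])]
  rfl

lemma coeff_expXi (x y : ℂ) (α : TimeIdx →₀ ℕ) : MvPowerSeries.coeff α (expXi x y) =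
    α.prod fun i e => (Sum.elim (fun m : ℕ+ => x ^ (m : ℕ)) (fun m : ℕ+ => y ^ (m : ℕ)) i) ^ e /
      (e.factorial : ℂ) := rfl

lemma constantCoeff_expXi (x y : ℂ) : MvPowerSeries.constantCoeff (expXi x y) = 1 := by
  rw [← MvPowerSeries.coeff_zero_eq_constantCoeff_apply, coeff_expXi, Finsupp.prod_zero_index]

lemma pderiv_expXi (x y : ℂ) (i : TimeIdx) : MvPowerSeries.pderiv ℂ i (expXi x y) =
    Sum.elim (fun m : ℕ+ => x ^ (m : ℕ)) (fun m : ℕ+ => y ^ (m : ℕ)) i • expXi x y := by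
  classical
  ext α
  rw [MvPowerSeries.coeff_pderiv, MvPowerSeries.coeff_smul, coeff_expXi, coeff_expXi]
  set f : TimeIdx → ℂ := Sum.elim (fun m : ℕ+ => x ^ (m : ℕ)) (fun m : ℕ+ => y ^ (m : ℕ))
  -- Only the factor at `i` differs between `α` and `α + single i 1`.
  have e1 : ∀ β : TimeIdx →₀ ℕ, β.prod (fun j e => f j ^ e / (e.factorial : ℂ)) =
      f i ^ β i / ((β i).factorial : ℂ) *
        (β.erase i).prod (fun j e => f j ^ e / (e.factorial : ℂ)) := fun β =>
    (Finsupp.mul_prod_erase' β i _ (by simp)).symm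
  rw [e1, e1 α]
  have e2 : (α + Finsupp.single i 1).erase i = α.erase i := by
    ext j
    by_cases h : j = i
    · simp [h]
    · simp [Finsupp.erase_ne h]
  rw [e2]
  simp only [Finsupp.add_apply, Finsupp.single_eq_same, Nat.factorial_succ, pow_succ]
  have h1 : ((α i : ℂ) + 1) ≠ 0 := by exact_mod_cast Nat.succ_ne_zero (α i)
  have h2 : (((α i).factorial : ℕ) : ℂ) ≠ 0 := by exact_mod_cast Nat.factorial_ne_zero (α i)
  push_cast
  field_simp

lemma pderiv_prod_eigen {ι : Type*} (s : Finset ι) (i : TimeIdx) (F : ι → TimeSeries) (c : ι → ℂ)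
    (h : ∀ j ∈ s, MvPowerSeries.pderiv ℂ i (F j) = c j • F j) :
    MvPowerSeries.pderiv ℂ i (∏ j ∈ s, F j) = (∑ j ∈ s, c j) • ∏ j ∈ s, F j := by
  classical
  induction s using Finset.induction_on with
  | empty => simp
  | insert j s hj ih =>
    rw [prod_insert hj, sum_insert hj, Derivation.leibniz, ih fun k hk => h k (by simp [hk]),
      h j (by simp)]
    simp only [smul_eq_mul, add_smul, mul_smul_comm]
    rw [add_comm, mul_comm (F j)]

variable {n : ℕ} (W : ℕ → ℕ → ℂ) (q₁ q₂ : ℂ)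

/-- The exponentials contribute the sum of `m`-th powers, and the factor `1/m` in `∂̃_m` turns it
into the power sum time. -/
lemma dTilde_zDiscrTerm (p : (Fin n → ℕ) × (Fin n → ℕ)) (i : TimeIdx) :
    dTilde i (zDiscrTerm n W q₁ q₂ p) =
      Sum.elim (powerTimes fun i => q₁ ^ p.1 i) (powerTimes fun i => q₂ ^ p.2 i) i •
        zDiscrTerm n W q₁ q₂ p := by
  rw [zDiscrTerm, dTilde_smul, dTilde, pderiv_prod_eigen univ i _ (fun j =>
    Sum.elim (fun m : ℕ+ => (q₁ ^ p.1 j) ^ (m : ℕ)) (fun m : ℕ+ => (q₂ ^ p.2 j) ^ (m : ℕ)) i),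
    smul_smul, smul_smul, smul_smul]
  · congr 1
    cases i <;> simp only [timeIndex, powerTimes, Sum.elim_inl, Sum.elim_inr] <;> ring
  · intro j _
    rw [Derivation.map_smul, pderiv_expXi, smul_comm]

lemma schurD_eigen {F : TimeSeries} {t t' : ℕ+ → ℂ} (h : ∀ i, dTilde i F = Sum.elim t t' i • F)
    (a : Ptn n) : schurD a F = schur a t • F := by
  rw [schurD, diffOp_eigen h, MvPolynomial.eval_rename, Sum.elim_comp_inl]
  rfl

lemma schurD'_eigen {F : TimeSeries} {t t' : ℕ+ → ℂ} (h : ∀ i, dTilde i F = Sum.elim t t' i • F)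
    (b : Ptn n) : schurD' b F = schur b t' • F := by
  rw [schurD', diffOp_eigen h, MvPolynomial.eval_rename, Sum.elim_comp_inr]
  rfl

lemma schurD_zero (F : TimeSeries) : schurD (Ptn.zero n) F = F := by
  have h : schurPoly (Ptn.zero n) = 1 :=
    MvPolynomial.funext fun t => by rw [map_one]; exact schur_zero t
  rw [schurD, h, map_one, diffOp]
  simp [MvPolynomial.support_one]

lemma schurD'_zero (F : TimeSeries) : schurD' (Ptn.zero n) F = F := by
  have h : schurPoly (Ptn.zero n) = 1 :=
    MvPolynomial.funext fun t => by rw [map_one]; exact schur_zero t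
  rw [schurD', h, map_one, diffOp]
  simp [MvPolynomial.support_one]

/-! ### Convergence of the discrete sums -/

lemma summable_prod_pi {ι : Type*} : ∀ {n : ℕ} {f : Fin n → ι → ℂ},
    (∀ i, Summable (f i)) → Summable fun g : Fin n → ι => ∏ i, f i (g i)
  | 0, _, _ => (hasSum_fintype _).summable
  | n + 1, f, hf => by
    rw [← (Fin.consEquiv fun _ : Fin (n + 1) => ι).summable_iff]
    have ih := summable_prod_pi (f := fun i => f i.succ) fun i => hf i.succ
    have h := summable_mul_of_summable_norm (hf 0).norm ih.norm
    refine h.congr fun p => ?_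
    simp [Fin.prod_univ_succ, Fin.consEquiv]

lemma summable_prod_pi_pair {f : Fin n → ℕ × ℕ → ℂ} (hf : ∀ i, Summable (f i)) :
    Summable fun p : (Fin n → ℕ) × (Fin n → ℕ) => ∏ i, f i (p.1 i, p.2 i) := by
  rw [← (Equiv.arrowProdEquivProdArrow (Fin n) (fun _ => ℕ) (fun _ => ℕ)).summable_iff]
  exact summable_prod_pi hf

variable {W q₁ q₂}

lemma summable_coeff_mul (hW : ∀ k m : ℕ, Summable fun p : ℕ × ℕ =>
    q₁ ^ (k * p.1) * q₂ ^ (m * p.2) * W p.1 p.2) (k m : ℕ) (α : TimeIdx →₀ ℕ) :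
    Summable fun p : ℕ × ℕ => (q₁ ^ p.1) ^ k * (q₂ ^ p.2) ^ m *
      MvPowerSeries.coeff α (W p.1 p.2 • expXi (q₁ ^ p.1) (q₂ ^ p.2)) := by
  -- A coefficient of `expXi x y` is a constant times a monomial in `x`, `y`, so it only shifts the
  -- exponents in `hW`.
  have key : ∃ c : ℂ, ∃ k' m' : ℕ, ∀ x y : ℂ,
      MvPowerSeries.coeff α (expXi x y) = c * (x ^ k' * y ^ m') := by
    simp only [coeff_expXi]
    induction α using Finsupp.induction with
    | zero => exact ⟨1, 0, 0, by simp⟩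
    | single_add i e α hi he ih =>
      obtain ⟨c, k', m', h⟩ := ih
      have h2 : ∀ x y : ℂ, (Finsupp.single i e + α).prod (fun i e =>
          (Sum.elim (fun m : ℕ+ => x ^ (m : ℕ)) (fun m : ℕ+ => y ^ (m : ℕ)) i) ^ e /
            (e.factorial : ℂ)) =
          (Sum.elim (fun m : ℕ+ => x ^ (m : ℕ)) (fun m : ℕ+ => y ^ (m : ℕ)) i) ^ e /
            (e.factorial : ℂ) * (c * (x ^ k' * y ^ m')) := by
        intro x y
        rw [Finsupp.prod_add_index_of_disjoint, Finsupp.prod_single_index (by simp), h]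
        simpa [Finsupp.support_single, he] using hi
      cases i with
      | inl j =>
        refine ⟨c / (e.factorial : ℂ), j * e + k', m', fun x y => ?_⟩
        rw [h2]
        simp only [Sum.elim_inl]
        ring
      | inr j =>
        refine ⟨c / (e.factorial : ℂ), k', j * e + m', fun x y => ?_⟩
        rw [h2]
        simp only [Sum.elim_inr]
        ring
  obtain ⟨c, k', m', h⟩ := key
  refine ((hW (k + k') (m + m')).mul_left c).congr fun p => ?_
  rw [MvPowerSeries.coeff_smul, h]
  ring

/-- Expanding both Vandermonde determinants and the coefficient of the product leaves finitely many
terms, each a product over `i` of summable functions of `(h_i, h'_i)` alone. -/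
lemma summable_coeff_zDiscrTerm (hW : ∀ k m : ℕ, Summable fun p : ℕ × ℕ =>
    q₁ ^ (k * p.1) * q₂ ^ (m * p.2) * W p.1 p.2) (α : TimeIdx →₀ ℕ) :
    Summable fun p => MvPowerSeries.coeff α (zDiscrTerm n W q₁ q₂ p) := by
  classical
  have h : ∀ p : (Fin n → ℕ) × (Fin n → ℕ), MvPowerSeries.coeff α (zDiscrTerm n W q₁ q₂ p) =
      ∑ σ : Equiv.Perm (Fin n), ∑ τ : Equiv.Perm (Fin n),
        ∑ l ∈ finsuppAntidiag univ α,
        ((Equiv.Perm.sign σ : ℤ) : ℂ) * ((Equiv.Perm.sign τ : ℤ) : ℂ) *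
        ∏ i, ((q₁ ^ p.1 i) ^ hseq (Ptn.zero n) (σ i) * (q₂ ^ p.2 i) ^ hseq (Ptn.zero n) (τ i) *
          MvPowerSeries.coeff (l i) (W (p.1 i) (p.2 i) • expXi (q₁ ^ p.1 i) (q₂ ^ p.2 i))) := by
    intro p
    rw [zDiscrTerm, MvPowerSeries.coeff_smul, MvPowerSeries.coeff_prod, ← alternant_zero,
      ← alternant_zero, alternant, alternant, ← Matrix.det_transpose, Matrix.det_apply',
      ← Matrix.det_transpose (Matrix.of _), Matrix.det_apply', sum_mul_sum, sum_mul]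
    refine sum_congr rfl fun σ _ => ?_
    rw [sum_mul]
    refine sum_congr rfl fun τ _ => ?_
    rw [mul_sum]
    refine sum_congr rfl fun l _ => ?_
    simp only [Matrix.transpose_apply, Matrix.of_apply, prod_mul_distrib]
    ring
  simp only [h]
  exact summable_sum fun σ _ => summable_sum fun τ _ => summable_sum fun l _ =>
    (summable_prod_pi_pair (f := fun i p => (q₁ ^ p.1) ^ hseq (Ptn.zero n) (σ i) *
      (q₂ ^ p.2) ^ hseq (Ptn.zero n) (τ i) *
      MvPowerSeries.coeff (l i) (W p.1 p.2 • expXi (q₁ ^ p.1) (q₂ ^ p.2)))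
      fun i => summable_coeff_mul hW _ _ _).mul_left _

/-! ### The discrete side in terms of alternants -/

lemma hasSum_coeff_schurD_zDiscr (hW : ∀ k m : ℕ, Summable fun p : ℕ × ℕ =>
    q₁ ^ (k * p.1) * q₂ ^ (m * p.2) * W p.1 p.2) (a b : Ptn n) (α : TimeIdx →₀ ℕ) :
    HasSum (fun p : (Fin n → ℕ) × (Fin n → ℕ) =>
      alternant (qpoints q₁ a) p.1 * alternant (qpoints q₂ b) p.2 *
        MvPowerSeries.coeff α (∏ i, (W (p.1 i) (p.2 i) • expXi (q₁ ^ p.1 i) (q₂ ^ p.2 i))))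
      ((n.factorial : ℂ) * MvPowerSeries.coeff α (schurD a (schurD' b (zDiscr n W q₁ q₂)))) := by
  have h0 : ∀ α, HasSum (fun p => MvPowerSeries.coeff α
      ((1 / (n.factorial : ℂ)) • zDiscrTerm n W q₁ q₂ p))
      (MvPowerSeries.coeff α (zDiscr n W q₁ q₂)) := fun α => by
    simp only [MvPowerSeries.coeff_smul]
    exact (summable_coeff_zDiscrTerm hW α).hasSum.mul_left _
  have h1 := hasSum_coeff_diffOp (hasSum_coeff_diffOp h0 (MvPolynomial.rename Sum.inr (schurPoly b)))
    (MvPolynomial.rename Sum.inl (schurPoly a)) α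
  refine (congrArg (HasSum · _) (funext fun p => ?_)).mp (h1.mul_left (n.factorial : ℂ))
  have hF : ∀ i, dTilde i ((1 / (n.factorial : ℂ)) • zDiscrTerm n W q₁ q₂ p) =
      Sum.elim (powerTimes fun i => q₁ ^ p.1 i) (powerTimes fun i => q₂ ^ p.2 i) i •
        ((1 / (n.factorial : ℂ)) • zDiscrTerm n W q₁ q₂ p) := fun i => by
    rw [dTilde_smul, dTilde_zDiscrTerm, smul_comm]
  change (n.factorial : ℂ) * MvPowerSeries.coeff α (schurD a (schurD' b _)) = _
  have hn : (n.factorial : ℂ) ≠ 0 := by exact_mod_cast n.factorial_ne_zero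
  rw [schurD'_eigen hF, schurD_eigen (fun i => by rw [dTilde_smul, hF, smul_comm]), zDiscrTerm]
  simp only [MvPowerSeries.coeff_smul]
  have e1 := schur_mul_vdm a (fun i => q₁ ^ p.1 i)
  have e2 := schur_mul_vdm b (fun i => q₂ ^ p.2 i)
  -- The summation variables move from the base points into the exponents.
  rw [alternant_pow_comm] at e1 e2
  change _ = alternant (fun i => q₁ ^ hseq a i) p.1 * alternant (fun i => q₂ ^ hseq b i) p.2 * _
  rw [← e1, ← e2]
  field_simp

/-- The sum over partitions of alternants times determinants of `W_{km} e^{ξ + ξ'}`. -/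
lemma hasSum_coeff_det (hW : ∀ k m : ℕ, Summable fun p : ℕ × ℕ =>
    q₁ ^ (k * p.1) * q₂ ^ (m * p.2) * W p.1 p.2) (a b : Ptn n) (α : TimeIdx →₀ ℕ) :
    HasSum (fun p : Ptn n × Ptn n => (n.factorial : ℂ) *
      (alternant (qpoints q₁ a) (hseq p.1) * alternant (qpoints q₂ b) (hseq p.2) *
        MvPowerSeries.coeff α (Matrix.det (Matrix.of fun i j =>
          W (hseq p.1 i) (hseq p.2 j) • expXi (q₁ ^ hseq p.1 i) (q₂ ^ hseq p.2 j)))))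
      ((n.factorial : ℂ) * MvPowerSeries.coeff α (schurD a (schurD' b (zDiscr n W q₁ q₂)))) :=
  hasSum_partitions_of_hasSum (MvPowerSeries.coeff α) _ _
    (fun k m => W k m • expXi (q₁ ^ k) (q₂ ^ m)) (hasSum_coeff_schurD_zDiscr hW a b α)

/-- If the multiple by `v` of a series has sum `s`, then the series converges unless `v = 0`, and
`v` times its (possibly junk) sum is `s` in either case. -/
lemma tsum_mul_eq_of_hasSum {ι : Type*} {f g : ι → ℂ} {s v : ℂ} (h : ∀ p, v * f p = g p)
    (hs : HasSum g s) : (v ≠ 0 → Summable f) ∧ v * ∑' p, f p = s := by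
  obtain rfl : (fun p => v * f p) = g := funext h
  by_cases hv : v = 0
  · subst hv
    simp only [zero_mul] at hs ⊢
    exact ⟨fun h => absurd rfl h, hasSum_zero.unique hs⟩
  · have := (summable_mul_left_iff hv).mp hs.summable
    exact ⟨fun _ => this, by rw [← tsum_mul_left, hs.tsum_eq]⟩

end NormalMatrixModel
end

/-! ### Comparison with the normal matrix series -/

noncomputable section
namespace NormalMatrixModel

variable {n : ℕ} {q₁ q₂ : ℂ} {W : ℕ → ℕ → ℂ}

lemma zNormalTermFormal_sum {wd : (TimeIdx →₀ ℕ) → ℂ → ℂ}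
    (hW : ∀ k m : ℕ, Summable fun p : ℕ × ℕ => q₁ ^ (k * p.1) * q₂ ^ (m * p.2) * W p.1 p.2)
    (hG : ∀ k m : ℕ, formalBimoment wd k m = W k m • expXi (q₁ ^ k) (q₂ ^ m)) (a b : Ptn n)
    (α : TimeIdx →₀ ℕ) :
    (vdm (qpoints q₁ a) * vdm (qpoints q₂ b) ≠ 0 →
      Summable fun p => MvPowerSeries.coeff α (zNormalTermFormal n (formalBimoment wd)
        (powerTimes (qpoints q₁ a)) (powerTimes (qpoints q₂ b)) p)) ∧
      MvPowerSeries.coeff α (zDualFormal n wd q₁ q₂ a b) =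
        (n.factorial : ℂ) * MvPowerSeries.coeff α (schurD a (schurD' b (zDiscr n W q₁ q₂))) := by
  refine tsum_mul_eq_of_hasSum (fun p => ?_) (hasSum_coeff_det hW a b α)
  simp only [zNormalTermFormal, MvPowerSeries.coeff_smul, hG, ← schur_mul_vdm]
  ring

/-- This is the coefficient `α = 0` of the determinant sum: `expXi` has constant term 1, so no
deformation of the weight is needed. -/
lemma zNormalTerm_sum {w : ℂ → ℂ}
    (hW : ∀ k m : ℕ, Summable fun p : ℕ × ℕ => q₁ ^ (k * p.1) * q₂ ^ (m * p.2) * W p.1 p.2)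
    (hg : ∀ k m : ℕ, bimoment w k m = W k m) (a b : Ptn n) :
    (vdm (qpoints q₁ a) * vdm (qpoints q₂ b) ≠ 0 →
      Summable (zNormalTerm n (bimoment w)
        (powerTimes (qpoints q₁ a)) (powerTimes (qpoints q₂ b)))) ∧
      zDual n w q₁ q₂ a b = (n.factorial : ℂ) *
        MvPowerSeries.constantCoeff (schurD a (schurD' b (zDiscr n W q₁ q₂))) := by
  have key := tsum_mul_eq_of_hasSum (f := zNormalTerm n (bimoment w)
    (powerTimes (qpoints q₁ a)) (powerTimes (qpoints q₂ b)))
    (v := vdm (qpoints q₁ a) * vdm (qpoints q₂ b)) (fun p => ?_) (hasSum_coeff_det hW a b 0)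
  · refine ⟨key.1, ?_⟩
    rw [← MvPowerSeries.coeff_zero_eq_constantCoeff_apply, ← key.2, zDual, zNormal]
    ring
  · rw [MvPowerSeries.coeff_zero_eq_constantCoeff_apply, RingHom.map_det]
    have : (MvPowerSeries.constantCoeff (σ := TimeIdx) (R := ℂ)).mapMatrix
        (Matrix.of fun i j : Fin n =>
          W (hseq p.1 i) (hseq p.2 j) • expXi (q₁ ^ hseq p.1 i) (q₂ ^ hseq p.2 j)) =
        Matrix.of fun i j : Fin n => W (hseq p.1 i) (hseq p.2 j) := by
      ext i j
      simp [MvPowerSeries.constantCoeff_smul, constantCoeff_expXi]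
    rw [this]
    simp only [zNormalTerm, hg, ← schur_mul_vdm]
    ring

end NormalMatrixModel
end

theorem theorem3 (n : ℕ) (q₁ q₂ : ℂ) (w : ℂ → ℂ) (W : ℕ → ℕ → ℂ)
    (hw : ∀ k m : ℕ, Integrable
      (fun z : ℂ => z ^ k * (starRingEnd ℂ z) ^ m * w z) volume)
    (hgW : ∀ k m : ℕ, bimoment w k m = W k m)
    (hW : ∀ k m : ℕ, Summable fun p : ℕ × ℕ => q₁ ^ (k * p.1) * q₂ ^ (m * p.2) * W p.1 p.2) :
    -- the coefficientwise sums that define the discrete partition function converge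
    (∀ α, Summable fun p =>
      MvPowerSeries.coeff α (zDiscrTerm n W q₁ q₂ p)) ∧
    -- the series of the normal matrix model converges at the chosen times
    (∀ a b : Ptn n,
      vdm (qpoints q₁ a)
        * vdm (qpoints q₂ b) ≠ 0 →
      Summable (zNormalTerm n (bimoment w)
        (powerTimes (qpoints q₁ a))
        (powerTimes (qpoints q₂ b)))) ∧
    -- zero partitions, at zero times of the discrete model
    zDual n w q₁ q₂
        (Ptn.zero n) (Ptn.zero n) =
      (n.factorial : ℂ) *
        MvPowerSeries.constantCoeff (zDiscr n W q₁ q₂) ∧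
    -- arbitrary partitions, at zero times of the discrete model
    (∀ a b : Ptn n,
      zDual n w q₁ q₂ a b =
        (n.factorial : ℂ) * MvPowerSeries.constantCoeff
          (schurD a (schurD' b
            (zDiscr n W q₁ q₂)))) ∧
    -- deformed potentials, at all times of the discrete model
    (∀ wd : (TimeIdx →₀ ℕ) → ℂ → ℂ,
      (∀ α, ∀ k m : ℕ, Integrable
        (fun z : ℂ => z ^ k * (starRingEnd ℂ z) ^ m * wd α z) volume) →
      (∀ k m : ℕ, formalBimoment wd k m =
        W k m • expXi (q₁ ^ k) (q₂ ^ m)) →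
      (∀ a b : Ptn n,
        vdm (qpoints q₁ a)
          * vdm (qpoints q₂ b) ≠ 0 →
        ∀ α, Summable fun p => MvPowerSeries.coeff α
          (zNormalTermFormal n (formalBimoment wd)
            (powerTimes (qpoints q₁ a))
            (powerTimes (qpoints q₂ b)) p)) ∧
      zDualFormal n wd q₁ q₂
          (Ptn.zero n) (Ptn.zero n) =
        (n.factorial : ℂ) • zDiscr n W q₁ q₂ ∧
      ∀ a b : Ptn n,
        zDualFormal n wd q₁ q₂ a b =
          (n.factorial : ℂ) • schurD a (schurD' b
            (zDiscr n W q₁ q₂))) := by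
  refine ⟨summable_coeff_zDiscrTerm hW, fun a b => (zNormalTerm_sum hW hgW a b).1, ?_,
    fun a b => (zNormalTerm_sum hW hgW a b).2, fun wd _ hG => ⟨fun a b h α =>
      (zNormalTermFormal_sum hW hG a b α).1 h, ?_, fun a b => ?_⟩⟩
  · rw [(zNormalTerm_sum hW hgW _ _).2, schurD'_zero, schurD_zero]
  · ext α
    rw [(zNormalTermFormal_sum hW hG _ _ α).2, schurD'_zero, schurD_zero,
      MvPowerSeries.coeff_smul]
  · ext α
    rw [(zNormalTermFormal_sum hW hG a b α).2, MvPowerSeries.coeff_smul]
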